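/- Let $N\ge 1$ and $\mathrm{BS}(N,N)=\langle a,b\mid a^Nb=ba^N\rangle$. Consider words in the letters $a^{\pm1},b^{\pm1}$ (not necessarily freely reduced). Let $\mathcal H$ be the set of words that generate an element of $\langle a\rangle$; let $\mathcal L$ (resp. $\mathcal K$) be the set of words $w\in\mathcal H$ that cannot be written as $w=uv$ with $u$ generating an element $b^{-1}a^j$ (resp. $ba^j$), $j\in\mathbb Z$. Let $$G(z;q),\ L(z;q),\ K(z;q)\in\mathbb Z[q,q^{-1}][[z]]$$ be the generating functions of $\mathcal H,\mathcal L,\mathcal K$, in which the coefficient of $z^nq^k$ is the number of words of length $n$ in the set that generate $a^k$. Write $\bar q=q^{-1}$ and let $\Phi_{N,N}$ be the operator that keeps exactly the terms whose exponent of $q$ is divisible by $N$: $$\Phi_{N,N}\circ\sum_n z^n\sum_k c_{n,k}q^k=\sum_n z^n\sum_j c_{n,Nj}q^{Nj}.$$ Put $L_0(z;q)=\Phi_{N,N}\circ L(z;q)$ and $\omega=e^{2\pi i/N}$. Then: 1. $K(z;q)=L(z;q)$, and $$L=1+z(q+\bar q)L+2z^2L\cdot[\Phi_{N,N}\circ L]-z^2[\Phi_{N,N}\circ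 L]^2,$$ $$G=1+z(q+\bar q)G+2z^2G\cdot[\Phi_{N,N}\circ L].$$ 2. In $\mathbb C[q,q^{-1}][[z]]$ the denominators below are invertible and $$N L_0(z;q)=\sum_{j=0}^{N-1}L(z;\omega^jq)=\sum_{j=0}^{N-1}\frac{1-z^2L_0(z;q)^2}{1-z\left(\omega^jq+\frac1{\omega^jq}\right)-2z^2L_0(z;q)}.$$ 3. $L_0(z;q)$, $L(z;q)$ and $G(z;q)$ are algebraic: each is a root of a nonzero one-variable polynomial with coefficients in $\mathbb Z[q,q^{-1}][z]$. 4. For $\mathrm{BS}(2,2)$, with $Q=q+\bar q$, $$1+3zQG-(1-4z^2-z^2Q^2)G^2-zQ(1-zQ-2z)(1-zQ+2z)G^3=0.$$ -/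

import Mathlib

noncomputable section

namespace BaumslagSolitar

/-- The two generators `a`, `b`. -/
inductive Gen where
  | a : Gen
  | b : Gen
deriving DecidableEq

instance : Fintype Gen where
  elems := {Gen.a, Gen.b}
  complete := fun x => by cases x <;> simp

/-- Words in the letters `a`, `a⁻¹`, `b`, `b⁻¹`, not necessarily freely reduced: `(x, true)` is the
letter `x`, and `(x, false)` is the letter `x⁻¹`. -/
abbrev Word : Type := List (Gen × Bool)

/-- The single relator `a ^ N * b * a ^ (-M) * b⁻¹`. -/
def relators (N M : ℕ) : Set (FreeGroup Gen) :=
  {FreeGroup.of Gen.a ^ N * FreeGroup.of Gen.b * (FreeGroup.of Gen.a ^ M)⁻¹ *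
    (FreeGroup.of Gen.b)⁻¹}

/-- The Baumslag-Solitar group `⟨a, b | a ^ N * b = b * a ^ M⟩`. -/
abbrev BS (N M : ℕ) : Type := PresentedGroup (relators N M)

/-- The image of `a` in the group. -/
def ga (N M : ℕ) : BS N M := PresentedGroup.of Gen.a

/-- The image of `b` in the group. -/
def gb (N M : ℕ) : BS N M := PresentedGroup.of Gen.b

/-- The group element generated by a word. -/
def val (N M : ℕ) (w : Word) : BS N M := PresentedGroup.mk (relators N M) (FreeGroup.mk w)

/-- Words generating an element of the horocyclic subgroup `⟨a⟩`. -/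
def wordsH (N M : ℕ) : Set Word := {w | ∃ k : ℤ, val N M w = ga N M ^ k}

/-- Words in `wordsH` without a prefix generating some `b⁻¹ * a ^ j`. -/
def wordsL (N M : ℕ) : Set Word :=
  {w | w ∈ wordsH N M ∧
    ¬ ∃ u v : Word, w = u ++ v ∧ ∃ j : ℤ, val N M u = (gb N M)⁻¹ * ga N M ^ j}

/-- Words in `wordsH` without a prefix generating some `b * a ^ j`. -/
def wordsK (N M : ℕ) : Set Word :=
  {w | w ∈ wordsH N M ∧
    ¬ ∃ u v : Word, w = u ++ v ∧ ∃ j : ℤ, val N M u = gb N M * ga N M ^ j}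

/-- The number of words in `S` of length `n` that generate `a ^ k`. -/
def count (N M : ℕ) (S : Set Word) (n : ℕ) (k : ℤ) : ℕ :=
  {w : Word | w ∈ S ∧ w.length = n ∧ val N M w = ga N M ^ k}.ncard

/-- Power series in `z` whose coefficients are Laurent polynomials in `q` over `R`. -/
abbrev Series (R : Type*) [CommRing R] : Type _ := PowerSeries (LaurentPolynomial R)

/-- The generating function `∑ n, ∑ k, count n k * z ^ n * q ^ k` of `S`. For each `n` only finitely
many `k` contribute as soon as `1 ≤ N` and `1 ≤ M`; see `coeff_genFun`. -/
def genFun (N M : ℕ) (S : Set Word) : Series ℤ :=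
  PowerSeries.mk fun n => ∑ᶠ k : ℤ, AddMonoidAlgebra.single k (count N M S n k : ℤ)

/-- The generating function `G(z; q)`. -/
def serG (N M : ℕ) : Series ℤ := genFun N M (wordsH N M)

/-- The generating function `L(z; q)`. -/
def serL (N M : ℕ) : Series ℤ := genFun N M (wordsL N M)

/-- The generating function `K(z; q)`. -/
def serK (N M : ℕ) : Series ℤ := genFun N M (wordsK N M)

/-- The operator sending `∑ n, z ^ n * ∑ k, c n k * q ^ k` to
`∑ n, z ^ n * ∑ j, c n (d * j) * q ^ (e * j)`. -/
def Phi (d e : ℕ) (f : Series ℤ) : Series ℤ :=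
  PowerSeries.mk fun n => (PowerSeries.coeff n f).coeff.sum fun k c =>
    if (d : ℤ) ∣ k then AddMonoidAlgebra.single ((e : ℤ) * (k / d)) c else 0

/-- The series `L₀ = Φ_{N,N} L` of `BS(N, N)`. -/
def serL0 (N : ℕ) : Series ℤ := Phi N N (serL N N)

/-- The variable `z`. -/
def zz (R : Type*) [CommRing R] : Series R := PowerSeries.X

/-- The element `c * q + (c * q)⁻¹` for an invertible constant `c`. -/
def QQ {R : Type*} [CommRing R] (c : Rˣ) : Series R :=
  PowerSeries.C (LaurentPolynomial.C (c : R) * LaurentPolynomial.T 1 +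
    LaurentPolynomial.C ((c⁻¹ : Rˣ) : R) * LaurentPolynomial.T (-1))

/-- The element `c * q` as a unit of the ring of complex Laurent polynomials. -/
def scaledQ (c : ℂˣ) : (LaurentPolynomial ℂ)ˣ where
  val := LaurentPolynomial.C (c : ℂ) * LaurentPolynomial.T 1
  inv := LaurentPolynomial.C ((c⁻¹ : ℂˣ) : ℂ) * LaurentPolynomial.T (-1)
  val_inv := by
    rw [mul_mul_mul_comm, ← map_mul, ← LaurentPolynomial.T_add]; simp
  inv_val := by
    rw [mul_mul_mul_comm, ← map_mul, ← LaurentPolynomial.T_add]; simp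

/-- The substitution `f(z; q) ↦ f(z; c * q)`, with values in series with complex coefficients. -/
def substQ (c : ℂˣ) : Series ℤ →+* Series ℂ :=
  PowerSeries.map
    (LaurentPolynomial.eval₂ (LaurentPolynomial.C.comp (Int.castRingHom ℂ)) (scaledQ c))

/-- The root of unity `exp (2 * π * i / N)`. -/
def omega (N : ℕ) : ℂˣ :=
  Units.mk0 (Complex.exp (2 * Real.pi * Complex.I / N)) (Complex.exp_ne_zero _)

/-- Algebraic over the field of rational functions in `z` and `q`: a root of a nonzero polynomial
whose coefficients are polynomials in `z`, `q`, `q⁻¹`. -/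
def IsAlg (f : Series ℤ) : Prop := IsAlgebraic (Polynomial (LaurentPolynomial ℤ)) f

/-- The element `a` has infinite order: the group acts on the rational line with `a` acting as
`x ↦ x + 1`. -/
theorem ga_zpow_injective {N M : ℕ} (hN : 1 ≤ N) (hM : 1 ≤ M) :
    Function.Injective fun k : ℤ => ga N M ^ k := by
  have hr : (N : ℚ) / M ≠ 0 := by positivity
  let F : Gen → Equiv.Perm ℚ := fun x => match x with
    | Gen.a => Equiv.addRight (1 : ℚ)
    | Gen.b => Equiv.mulLeft₀ ((N : ℚ) / M) hr
  have hpow : ∀ (n : ℕ) (x : ℚ), (Equiv.addRight (1 : ℚ) ^ n) x = x + n := by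
    intro n
    induction n with
    | zero => simp
    | succ n ih => intro x; rw [pow_succ, Equiv.Perm.mul_apply, ih]; simp; ring
  have hF : ∀ r ∈ relators N M, FreeGroup.lift F r = 1 := by
    intro r hr'
    rw [relators, Set.mem_singleton_iff] at hr'
    subst hr'
    simp only [map_mul, map_pow, map_inv, FreeGroup.lift_apply_of]
    rw [mul_inv_eq_one, mul_inv_eq_iff_eq_mul]
    ext x
    simp only [Equiv.Perm.mul_apply, F, hpow, Equiv.mulLeft₀_apply]
    have : (M : ℚ) ≠ 0 := by positivity
    field_simp
  have hzpow : ∀ (k : ℤ) (x : ℚ), (Equiv.addRight (1 : ℚ) ^ k) x = x + k := by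
    intro k x
    cases k with
    | ofNat n => simp
    | negSucc n =>
      rw [zpow_negSucc, Equiv.Perm.inv_eq_iff_eq, hpow]
      push_cast
      ring
  intro k l hkl
  have h := congrArg (fun g => (PresentedGroup.toGroup hF g) (0 : ℚ)) hkl
  simp only [ga, map_zpow, PresentedGroup.toGroup.of, F, hzpow, zero_add] at h
  exact_mod_cast h

/-- The coefficient of `z ^ n * q ^ k` in the generating function is the number of words. -/
theorem coeff_genFun {N M : ℕ} (hN : 1 ≤ N) (hM : 1 ≤ M) (S : Set Word) (n : ℕ) (k : ℤ) :
    (PowerSeries.coeff n (genFun N M S)).coeff k = count N M S n k := by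
  have hfin : {w : Word | w.length = n}.Finite := List.finite_length_eq _ n
  have hs : (Function.support fun k : ℤ =>
      (AddMonoidAlgebra.single k (count N M S n k : ℤ) : LaurentPolynomial ℤ)).Finite := by
    refine ((hfin.image (val N M)).preimage
      (f := fun k : ℤ => ga N M ^ k) (ga_zpow_injective hN hM).injOn).subset ?_
    intro k hk
    have hc : count N M S n k ≠ 0 := by
      intro h0
      simp [h0] at hk
    obtain ⟨w, -, hw, hv⟩ := Set.nonempty_of_ncard_ne_zero hc
    exact ⟨w, hw, hv⟩
  rw [genFun, PowerSeries.coeff_mk, finsum_eq_sum _ hs]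
  have hsum : ∀ (t : Finset ℤ) (c : ℤ → ℤ),
      (∑ i ∈ t, AddMonoidAlgebra.single i (c i) : LaurentPolynomial ℤ).coeff k =
        if k ∈ t then c k else 0 := by
    intro t c
    classical
    induction t using Finset.induction_on with
    | empty => simp
    | insert i t hi ih =>
      rw [Finset.sum_insert hi, AddMonoidAlgebra.coeff_add, Finsupp.add_apply, ih,
        AddMonoidAlgebra.coeff_single, Finsupp.single_apply]
      by_cases h : i = k
      · subst h; simp [hi]
      · simp [h, Ne.symm h]
  rw [hsum]
  by_cases hk : count N M S n k = 0
  · simp [hk]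
  · rw [if_pos]
    rw [Set.Finite.mem_toFinset, Function.mem_support]
    intro h0
    have := congrArg (fun f : LaurentPolynomial ℤ => f.coeff k) h0
    rw [AddMonoidAlgebra.coeff_single] at this
    exact hk (by simpa using this)

end BaumslagSolitar

end

open BaumslagSolitar

/-!
Since `a ^ N` is central, every element of `BS(N, N)` has a unique normal form
`a ^ i₁ * b ^ e₁ * ... * a ^ iₛ * b ^ eₛ * a ^ m` with `0 ≤ iⱼ < N`, `eⱼ = ±1` and no cancelling
factors. The factors before `a ^ m` form a stack, on which `b` and `b⁻¹` act by pushing or popping.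
That the letters act by permutations satisfying the relation (`rho`) shows that the normal form
computed by `run` depends only on the group element, so `⟨a⟩` is the set of elements with empty
stack (`mem_wordsH_iff`) and `b^{±1}⟨a⟩` consists of those with stack `[(0, ±)]`.

A nonempty word in `⟨a⟩` ends either in `a^{±1}` or in an excursion `b^e u b^{-e}`, where `u`
generates a power of `a ^ N` and avoids `b^{-e}⟨a⟩` (`bijOn_excursion`). An excursion meets `b^f⟨a⟩`
only if `f = e` and the preceding word generates a power of `a ^ N`. Counting by the last letter
(`weightSum_wordsC`) gives the equations for `L` and `G`, where `K = L` by the symmetry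
exchanging `b` and `b⁻¹`.

The equation for `L` is linear in `L` over the series in `q ^ N`, with coefficients involving `L₀`.
Substituting `q ↦ ω ^ j * q` fixes `L₀`, and solving for `L` and summing over `j` gives the equation
for `L₀`. Splitting it instead into the parts of `L` with exponents in a residue class modulo `N`
(`part_serL_equation`) gives a linear system with a cyclic `N × N` matrix; Cramer's rule yields an
algebraic equation for `L₀` with coefficients in `ℤ[q, q⁻¹][z]`, nontrivial because the matrix is
the identity at `z = 0`. Then `L` and `G` are rational functions of `L₀`, `z` and `q`. For `N = 2`
eliminating the odd part of `L` from the system gives the cubic equation for `G`.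
-/

noncomputable section

namespace BaumslagSolitar

/-! ### Normal forms -/

/-- Right multiplication by `b` (`e = true`) or `b⁻¹` (`e = false`) on normal forms.

A normal form `(σ, m)` consists of a stack `σ` and an exponent `m`. An entry `(i, e)` of the stack
stands for `a ^ i * b` or `a ^ i * b⁻¹`, according to `e`, and the top of the stack (the head of the
list) is the last factor, so that `(σ, m)` stands for the product of the entries from the bottom to
the top, followed by `a ^ m`. Multiplying by `b ^ e` moves the largest multiple of `a ^ N` past the
new letter, which then either cancels the top entry or is pushed together with the residue
`m % N`. -/
def stepB (N : ℕ) (e : Bool) : List (ℤ × Bool) × ℤ → List (ℤ × Bool) × ℤ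
  | ([], m) => ([(m % N, e)], m - m % N)
  | ((i, f) :: σ, m) =>
    if m % N = 0 ∧ f = !e then (σ, i + m) else ((m % N, e) :: (i, f) :: σ, m - m % N)

/-- Right multiplication by a letter on normal forms. -/
def act (N : ℕ) (s : List (ℤ × Bool) × ℤ) : Gen × Bool → List (ℤ × Bool) × ℤ
  | (Gen.a, true) => (s.1, s.2 + 1)
  | (Gen.a, false) => (s.1, s.2 - 1)
  | (Gen.b, e) => stepB N e s

/-- The normal form of the group element generated by a word, computed letter by letter. -/
def run (N : ℕ) (w : Word) : List (ℤ × Bool) × ℤ := w.foldl (act N) ([], 0)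

/-- Reduced stacks: the residues lie in `[0, N)` and no entry cancels the one below it. -/
def Valid (N : ℕ) : List (ℤ × Bool) → Prop
  | [] => True
  | [(i, _)] => 0 ≤ i ∧ i < N
  | (i, e) :: (j, f) :: σ => 0 ≤ i ∧ i < N ∧ ¬ (i = 0 ∧ f = !e) ∧ Valid N ((j, f) :: σ)

theorem Valid.tail {N : ℕ} {c : ℤ × Bool} {σ : List (ℤ × Bool)} (h : Valid N (c :: σ)) :
    Valid N σ := by
  match σ, h with
  | [], _ => trivial
  | _ :: _, h => exact h.2.2.2

theorem Valid.stepB {N : ℕ} (hN : 1 ≤ N) (e : Bool) {s : List (ℤ × Bool) × ℤ}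
    (h : Valid N s.1) : Valid N (stepB N e s).1 := by
  have hpos : (0 : ℤ) < N := by exact_mod_cast hN
  obtain ⟨σ, m⟩ := s
  have h0 := Int.emod_nonneg m hpos.ne'
  have h1 := Int.emod_lt_of_pos m hpos
  match σ, h with
  | [], _ => exact ⟨h0, h1⟩
  | (i, f) :: σ, h =>
    rw [BaumslagSolitar.stepB]
    split_ifs with hc
    · exact h.tail
    · exact ⟨h0, h1, hc, h⟩

/-- Multiplication by `b ^ e` is undone by multiplication by `b ^ (-e)`. An unreduced stack can fail
this: after a pop, the second letter would cancel a further entry instead of being pushed back. -/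
theorem stepB_not_stepB {N : ℕ} (e : Bool) {s : List (ℤ × Bool) × ℤ} (h : Valid N s.1) :
    stepB N (!e) (stepB N e s) = s := by
  obtain ⟨σ, m⟩ := s
  match σ, h with
  | [], _ => simp [stepB]
  | (i, f) :: σ, h =>
    rw [stepB]
    split_ifs with hc
    · obtain ⟨hm, rfl⟩ := hc
      match σ, h with
      | [], h =>
        have : (i + m) % N = i := by
          rw [Int.add_emod, hm, add_zero, Int.emod_emod, Int.emod_eq_of_lt h.1 h.2]
        simp [stepB, this]
      | (j, f) :: σ, h =>
        have : (i + m) % N = i := by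
          rw [Int.add_emod, hm, add_zero, Int.emod_emod, Int.emod_eq_of_lt h.1 h.2.1]
        have h' := h.2.2.1
        rw [stepB, this, if_neg h']
        simp
    · simp [stepB]

/-- Powers of `a ^ N` pass through `b`. -/
theorem stepB_add {N : ℕ} (e : Bool) (σ : List (ℤ × Bool)) (m : ℤ) {d : ℤ} (hd : (N : ℤ) ∣ d) :
    stepB N e (σ, m + d) = ((stepB N e (σ, m)).1, (stepB N e (σ, m)).2 + d) := by
  have : (m + d) % N = m % N := by
    rw [Int.add_emod, Int.emod_eq_zero_of_dvd hd, add_zero, Int.emod_emod]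
  match σ with
  | [] => simp [stepB, this]; ring
  | (i, f) :: σ =>
    rw [stepB, stepB, this]
    split_ifs <;> simp <;> ring

/-- The reduced normal forms, on which every letter acts by a permutation. -/
abbrev NState (N : ℕ) : Type := {s : List (ℤ × Bool) × ℤ // Valid N s.1}

/-- Right multiplication by `a` on normal forms. -/
def permA (N : ℕ) : Equiv.Perm (NState N) where
  toFun s := ⟨(s.1.1, s.1.2 + 1), s.2⟩
  invFun s := ⟨(s.1.1, s.1.2 - 1), s.2⟩
  left_inv s := by ext <;> simp
  right_inv s := by ext <;> simp

/-- Right multiplication by `b` on normal forms. -/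
def permB {N : ℕ} (hN : 1 ≤ N) : Equiv.Perm (NState N) where
  toFun s := ⟨stepB N true s.1, s.2.stepB hN true⟩
  invFun s := ⟨stepB N false s.1, s.2.stepB hN false⟩
  left_inv s := Subtype.ext (stepB_not_stepB true s.2)
  right_inv s := Subtype.ext (stepB_not_stepB false s.2)

theorem permA_pow_apply (N n : ℕ) (s : NState N) :
    (permA N ^ n) s = ⟨(s.1.1, s.1.2 + n), s.2⟩ := by
  induction n with
  | zero => simp
  | succ n ih =>
    rw [pow_succ', Equiv.Perm.mul_apply, ih]
    simp [permA, add_assoc]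

/-- The permutations attached to the generators; since they act on the right, they are taken in
the opposite group. -/
def genPerm {N : ℕ} (hN : 1 ≤ N) : Gen → (Equiv.Perm (NState N))ᵐᵒᵖ
  | Gen.a => MulOpposite.op (permA N)
  | Gen.b => MulOpposite.op (permB hN)

theorem lift_genPerm_relators {N : ℕ} (hN : 1 ≤ N) :
    ∀ r ∈ relators N N, FreeGroup.lift (genPerm hN) r = 1 := by
  intro r hr
  rw [relators, Set.mem_singleton_iff] at hr
  subst hr
  simp only [map_mul, map_pow, map_inv, FreeGroup.lift_apply_of, genPerm]
  rw [mul_inv_eq_one, mul_inv_eq_iff_eq_mul, ← MulOpposite.op_pow, ← MulOpposite.op_mul,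
    ← MulOpposite.op_mul]
  congr 1
  ext1 s
  simp only [Equiv.Perm.mul_apply, permA_pow_apply]
  exact Subtype.ext (stepB_add true s.1.1 s.1.2 (dvd_refl _))

/-- The right action of the group on normal forms. -/
def rho {N : ℕ} (hN : 1 ≤ N) : BS N N →* (Equiv.Perm (NState N))ᵐᵒᵖ :=
  PresentedGroup.toGroup (lift_genPerm_relators hN)

theorem rho_val {N : ℕ} (hN : 1 ≤ N) (w : Word) (s : NState N) :
    (((rho hN (val N N w)).unop s : NState N) : List (ℤ × Bool) × ℤ) =
      w.foldl (act N) s.1 := by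
  have h : rho hN (val N N w) = FreeGroup.lift (genPerm hN) (FreeGroup.mk w) := rfl
  rw [h, FreeGroup.lift_mk]
  induction w generalizing s with
  | nil => simp
  | cons l w ih =>
    rw [List.map_cons, List.prod_cons, MulOpposite.unop_mul, Equiv.Perm.mul_apply,
      ih _ (by rfl), List.foldl_cons]
    congr 1
    rcases l with ⟨_ | _, _ | _⟩ <;> rfl

theorem run_eq_of_val_eq {N : ℕ} (hN : 1 ≤ N) {w w' : Word} (h : val N N w = val N N w') :
    run N w = run N w' := by
  have := rho_val hN w ⟨([], 0), trivial⟩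
  rw [h, rho_val] at this
  exact this.symm

/-- The exponent of the letter `(Gen.b, e)`. -/
def sgn (e : Bool) : ℤ := if e then 1 else -1

theorem sgn_not (e : Bool) : sgn (!e) = -sgn e := by cases e <;> rfl

/-- The group element represented by a stack. -/
def stackVal (N : ℕ) : List (ℤ × Bool) → BS N N
  | [] => 1
  | (i, e) :: σ => stackVal N σ * ga N N ^ i * gb N N ^ sgn e

theorem commute_ga_pow_gb (N : ℕ) : Commute (ga N N ^ N) (gb N N) := by
  have h : PresentedGroup.mk (relators N N) (FreeGroup.of Gen.a ^ N * FreeGroup.of Gen.b *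
      (FreeGroup.of Gen.a ^ N)⁻¹ * (FreeGroup.of Gen.b)⁻¹) = 1 :=
    PresentedGroup.one_of_mem rfl
  simp only [map_mul, map_pow, map_inv] at h
  rw [mul_inv_eq_one, mul_inv_eq_iff_eq_mul] at h
  exact h

theorem commute_ga_zpow_gb_zpow {N : ℕ} {d : ℤ} (hd : (N : ℤ) ∣ d) (k : ℤ) :
    Commute (ga N N ^ d) (gb N N ^ k) := by
  obtain ⟨c, rfl⟩ := hd
  rw [zpow_mul, zpow_natCast]
  exact ((commute_ga_pow_gb N).zpow_left c).zpow_right k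

theorem stackVal_stepB {N : ℕ} (e : Bool) (s : List (ℤ × Bool) × ℤ) :
    stackVal N (stepB N e s).1 * ga N N ^ (stepB N e s).2 =
      stackVal N s.1 * ga N N ^ s.2 * gb N N ^ sgn e := by
  obtain ⟨σ, m⟩ := s
  have key : ga N N ^ (m % N) * gb N N ^ sgn e * ga N N ^ (m - m % N) =
      ga N N ^ m * gb N N ^ sgn e := by
    rw [mul_assoc, ← (commute_ga_zpow_gb_zpow (Int.dvd_self_sub_emod) _).eq, ← mul_assoc,
      ← zpow_add]
    congr 2; ring
  match σ with
  | [] => simp only [stepB, stackVal, one_mul, key]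
  | (i, f) :: σ =>
    rw [stepB]
    split_ifs with hc
    · obtain ⟨hm, rfl⟩ := hc
      have := (commute_ga_zpow_gb_zpow (N := N) (Int.dvd_of_emod_eq_zero hm) (sgn e)).eq
      rw [stackVal, mul_assoc _ (ga N N ^ m), this, sgn_not, zpow_neg]
      simp only [mul_assoc, zpow_add, inv_mul_cancel_left]
    · rw [mul_assoc _ (ga N N ^ m), ← key]
      simp only [stackVal, mul_assoc]

theorem val_append (N : ℕ) (u v : Word) : val N N (u ++ v) = val N N u * val N N v := by
  rw [val, ← FreeGroup.mul_mk, map_mul]; rfl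

theorem val_letter (N : ℕ) (x : Gen) (e : Bool) :
    val N N [(x, e)] = (PresentedGroup.of x : BS N N) ^ sgn e := by
  cases e
  · rw [sgn, if_neg (by simp), zpow_neg, zpow_one]
    rfl
  · rw [sgn, if_pos rfl, zpow_one]
    rfl

theorem run_concat (N : ℕ) (w : Word) (l : Gen × Bool) :
    run N (w ++ [l]) = act N (run N w) l := by
  simp [run]

theorem val_eq_run (N : ℕ) (w : Word) :
    val N N w = stackVal N (run N w).1 * ga N N ^ (run N w).2 := by
  induction w using List.reverseRecOn with
  | nil => simp [run, stackVal, val]; rfl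
  | append_singleton w l ih =>
    rw [val_append, run_concat, ih]
    rcases l with ⟨_ | _, e⟩
    · rw [val_letter]
      cases e
      · simp only [act, sgn, Bool.false_eq_true, if_false, zpow_sub, zpow_neg, zpow_one, mul_assoc]
        rfl
      · simp only [act, sgn, if_true, zpow_add, zpow_one, mul_assoc]
        rfl
    · rw [act, stackVal_stepB, val_letter]
      rfl

theorem exists_run_append (N : ℕ) (u : Word) (k : ℤ) :
    ∃ v : Word, run N (u ++ v) = ((run N u).1, (run N u).2 + k) := by
  induction k using Int.induction_on with
  | zero => exact ⟨[], by simp⟩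
  | succ k ih =>
    obtain ⟨v, hv⟩ := ih
    refine ⟨v ++ [(Gen.a, true)], ?_⟩
    rw [← List.append_assoc, run_concat, hv, act, add_assoc]
  | pred k ih =>
    obtain ⟨v, hv⟩ := ih
    refine ⟨v ++ [(Gen.a, false)], ?_⟩
    rw [← List.append_assoc, run_concat, hv, act, add_sub_assoc]

/-- Two words differ by a right factor `a ^ k` exactly when their normal forms have the same stack
and exponents differing by `k`. -/
theorem val_eq_iff {N : ℕ} (hN : 1 ≤ N) (w u : Word) (k : ℤ) :
    val N N w = val N N u * ga N N ^ k ↔ run N w = ((run N u).1, (run N u).2 + k) := by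
  constructor
  · intro h
    obtain ⟨v, hv⟩ := exists_run_append N u k
    rw [← hv]
    refine run_eq_of_val_eq hN ?_
    rw [h, val_eq_run N (u ++ v), hv, val_eq_run N u, zpow_add, mul_assoc]
  · intro h
    rw [val_eq_run, h, val_eq_run N u, zpow_add, mul_assoc]

/-- A word generates `a ^ k` exactly when its normal form has empty stack and exponent `k`. -/
theorem val_eq_zpow_iff {N : ℕ} (hN : 1 ≤ N) (w : Word) (k : ℤ) :
    val N N w = ga N N ^ k ↔ run N w = ([], k) := by
  have h := val_eq_iff hN w [] k
  have h1 : val N N [] = 1 := map_one _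
  rwa [h1, one_mul, show run N [] = ([], 0) from rfl, zero_add] at h

theorem mem_wordsH_iff {N : ℕ} (hN : 1 ≤ N) (w : Word) :
    w ∈ wordsH N N ↔ (run N w).1 = [] := by
  simp only [wordsH, Set.mem_ofPred_eq, val_eq_zpow_iff hN]
  exact ⟨fun ⟨k, hk⟩ => by rw [hk], fun h => ⟨(run N w).2, Prod.ext h rfl⟩⟩

theorem exists_val_eq_iff {N : ℕ} (hN : 1 ≤ N) (w : Word) (e : Bool) :
    (∃ j : ℤ, val N N w = gb N N ^ sgn e * ga N N ^ j) ↔ (run N w).1 = [(0, e)] := by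
  have h (j : ℤ) := val_eq_iff hN w [(Gen.b, e)] j
  have h2 : run N [(Gen.b, e)] = ([(0, e)], 0) := by simp [run, act, stepB]
  simp only [val_letter, h2, zero_add] at h
  constructor
  · rintro ⟨j, hj⟩
    rw [(h j).1 hj]
  · intro hw
    exact ⟨(run N w).2, (h _).2 (Prod.ext hw rfl)⟩

/-! ### Avoided cosets -/

theorem prefix_append_cons_iff {α : Type*} {p v u : List α} {l : α} :
    p <+: v ++ l :: u ↔ p <+: v ∨ ∃ q, q <+: u ∧ p = v ++ l :: q := by
  constructor
  · induction v generalizing p with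
    | nil =>
      intro h
      rw [List.nil_append, List.prefix_cons_iff] at h
      rcases h with rfl | ⟨q, rfl, hq⟩
      · exact Or.inl (List.prefix_refl _)
      · exact Or.inr ⟨q, hq, rfl⟩
    | cons x v ih =>
      intro h
      rw [List.cons_append, List.prefix_cons_iff] at h
      rcases h with rfl | ⟨t, rfl, ht⟩
      · exact Or.inl List.nil_prefix
      · rcases ih ht with h | ⟨q, hq, rfl⟩
        · exact Or.inl (List.cons_prefix_cons.2 ⟨rfl, h⟩)
        · exact Or.inr ⟨q, hq, rfl⟩
  · rintro (h | ⟨q, hq, rfl⟩)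
    · exact h.trans (List.prefix_append _ _)
    · exact (List.prefix_append_right_inj v).2 (List.cons_prefix_cons.2 ⟨rfl, hq⟩)

/-- `Avoids N e w`: no prefix of `w` generates an element of the coset `b⟨a⟩` (`e = true`) or
`b⁻¹⟨a⟩` (`e = false`). -/
def Avoids (N : ℕ) (e : Bool) (w : Word) : Prop := ∀ p, p <+: w → (run N p).1 ≠ [(0, e)]

theorem Avoids.mono {N : ℕ} {e : Bool} {w w' : Word} (h : Avoids N e w) (hw : w' <+: w) :
    Avoids N e w' := fun p hp => h p (hp.trans hw)

theorem avoids_concat_iff {N : ℕ} {e : Bool} {w : Word} {l : Gen × Bool} :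
    Avoids N e (w ++ [l]) ↔ Avoids N e w ∧ (run N (w ++ [l])).1 ≠ [(0, e)] := by
  simp only [Avoids, List.prefix_concat_iff]
  constructor
  · exact fun h => ⟨fun p hp => h p (Or.inr hp), h _ (Or.inl rfl)⟩
  · rintro ⟨h1, h2⟩ p (rfl | hp)
    exacts [h2, h1 p hp]

/-- Words in `⟨a⟩` avoiding `b^e⟨a⟩` for all `e ∈ B`. -/
def wordsC (N : ℕ) (B : Set Bool) : Set Word :=
  {w | (run N w).1 = [] ∧ ∀ e ∈ B, Avoids N e w}

theorem wordsH_eq {N : ℕ} (hN : 1 ≤ N) : wordsH N N = wordsC N ∅ := by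
  ext w
  rw [mem_wordsH_iff hN]
  simp [wordsC]

theorem avoids_iff {N : ℕ} (hN : 1 ≤ N) (w : Word) (e : Bool) :
    Avoids N e w ↔
      ¬ ∃ u v : Word, w = u ++ v ∧ ∃ j : ℤ, val N N u = gb N N ^ sgn e * ga N N ^ j := by
  simp only [exists_val_eq_iff hN]
  constructor
  · rintro h ⟨u, v, rfl, hu⟩
    exact h u (List.prefix_append _ _) hu
  · rintro h p ⟨v, rfl⟩ hp
    exact h ⟨p, v, rfl, hp⟩

theorem wordsL_eq {N : ℕ} (hN : 1 ≤ N) : wordsL N N = wordsC N {false} := by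
  ext w
  have := avoids_iff hN w false
  simp only [sgn, Bool.false_eq_true, if_false, zpow_neg, zpow_one] at this
  simp [wordsC, wordsL, mem_wordsH_iff hN, this]

theorem wordsK_eq {N : ℕ} (hN : 1 ≤ N) : wordsK N N = wordsC N {true} := by
  ext w
  have := avoids_iff hN w true
  simp only [sgn, if_true, zpow_one] at this
  simp [wordsC, wordsK, mem_wordsH_iff hN, this]

/-! ### Excursions -/

/-- A letter acts in the same way above a bottom entry `(i, f)`, unless it would pop that entry. -/
theorem act_append {N : ℕ} {τ : List (ℤ × Bool)} {m d i : ℤ} {f : Bool} {l : Gen × Bool}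
    (hd : (N : ℤ) ∣ d) (h : (act N (τ, m) l).1 ≠ [(0, !f)]) :
    act N (τ ++ [(i, f)], m + d) l =
      ((act N (τ, m) l).1 ++ [(i, f)], (act N (τ, m) l).2 + d) := by
  rcases l with ⟨_ | _, e⟩
  · cases e <;> simp [act] <;> ring
  · simp only [act] at h ⊢
    rw [stepB_add _ _ _ hd]
    match τ with
    | [] =>
      simp only [stepB, List.nil_append] at h ⊢
      rw [if_neg]
      · rfl
      · rintro ⟨h1, rfl⟩
        simp [h1] at h
    | (j, g) :: τ =>
      simp only [stepB, List.cons_append]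
      split_ifs <;> simp

/-- If a letter acting above a bottom entry `(i, f)` does not pop that entry, then without that
entry it does not put `(0, !f)` at the bottom of the stack. -/
theorem getLast?_act {N : ℕ} {τ : List (ℤ × Bool)} {m d i : ℤ} {f : Bool} {l : Gen × Bool}
    (hd : (N : ℤ) ∣ d) (hτ : τ.getLast? ≠ some (0, !f))
    (h : (act N (τ ++ [(i, f)], m + d) l).1 ≠ []) :
    (act N (τ, m) l).1.getLast? ≠ some (0, !f) := by
  rcases l with ⟨_ | _, e⟩
  · cases e <;> simpa [act] using hτ
  · simp only [act] at h ⊢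
    rw [stepB_add _ _ _ hd] at h
    match τ with
    | [] =>
      simp only [stepB, List.nil_append] at h ⊢
      intro h2
      simp only [List.getLast?_singleton, Option.some.injEq, Prod.mk.injEq] at h2
      obtain ⟨h2, rfl⟩ := h2
      simp [h2] at h
    | (j, g) :: τ =>
      simp only [stepB]
      split_ifs
      · cases τ with
        | nil => simp
        | cons c τ => simpa [List.getLast?_cons_cons] using hτ
      · simpa [List.getLast?_cons_cons] using hτ

/-- A word avoiding `b^{-f}⟨a⟩` runs in the same way above a bottom entry `(i, f)`. -/
theorem foldl_act_of_avoids {N : ℕ} {d i : ℤ} {f : Bool} (hd : (N : ℤ) ∣ d) {u : Word}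
    (hu : Avoids N (!f) u) :
    u.foldl (act N) ([(i, f)], d) = ((run N u).1 ++ [(i, f)], (run N u).2 + d) := by
  induction u using List.reverseRecOn with
  | nil => simp [run]
  | append_singleton u l ih =>
    rw [avoids_concat_iff] at hu
    rw [List.foldl_append, ih hu.1, run_concat] at *
    exact act_append hd hu.2

/-- A word that never empties the stack `[(i, f)]` avoids `b^{-f}⟨a⟩`. The condition on the bottom
entry makes the induction work. -/
theorem avoids_of_foldl_act_ne_nil {N : ℕ} {d i : ℤ} {f : Bool} (hd : (N : ℤ) ∣ d) {u : Word}
    (hu : ∀ p, p <+: u → (p.foldl (act N) ([(i, f)], d)).1 ≠ []) :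
    Avoids N (!f) u ∧ (run N u).1.getLast? ≠ some (0, !f) := by
  induction u using List.reverseRecOn with
  | nil => simp [Avoids, run]
  | append_singleton u l ih =>
    obtain ⟨h1, h2⟩ := ih fun p hp => hu p (hp.trans (List.prefix_append _ _))
    have h3 := hu _ (List.prefix_refl _)
    rw [List.foldl_append, foldl_act_of_avoids hd h1] at h3
    have h4 := getLast?_act hd h2 h3
    rw [avoids_concat_iff, run_concat]
    exact ⟨⟨h1, fun h => h4 (by rw [show act N (run N u) l = _ from rfl, h]; rfl)⟩, h4⟩

theorem run_append_cons {N : ℕ} {v u : Word} {e : Bool} (hv : (run N v).1 = [])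
    (hu : Avoids N (!e) u) :
    run N (v ++ (Gen.b, e) :: u) = ((run N u).1 ++ [((run N v).2 % N, e)],
      (run N u).2 + ((run N v).2 - (run N v).2 % N)) := by
  rw [← foldl_act_of_avoids Int.dvd_self_sub_emod hu, run, List.foldl_append, List.foldl_cons]
  congr 1
  change act N (run N v) _ = _
  rw [← Prod.mk.eta (p := run N v), hv]
  rfl

/-- The word obtained by appending to `v` the excursion `b^e u b^{-e}`. -/
def excursion (e : Bool) (p : Word × Word) : Word := p.1 ++ (Gen.b, e) :: p.2 ++ [(Gen.b, !e)]

theorem run_excursion {N : ℕ} {v u : Word} {e : Bool} (hv : (run N v).1 = [])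
    (hu : Avoids N (!e) u) (hu1 : (run N u).1 = []) (hu2 : (N : ℤ) ∣ (run N u).2) :
    run N (excursion e (v, u)) = ([], (run N v).2 + (run N u).2) := by
  rw [excursion, run_concat, run_append_cons hv hu, hu1]
  have : ((run N u).2 + ((run N v).2 - (run N v).2 % N)) % N = 0 :=
    Int.emod_eq_zero_of_dvd (dvd_add hu2 Int.dvd_self_sub_emod)
  simp only [act, stepB, List.nil_append, this]
  simp; ring

/-- Every word in `⟨a⟩` ending in `b^{-e}` is uniquely a word `v` in `⟨a⟩` followed by an excursion
`b^e u b^{-e}`, where `u` avoids `b^{-e}⟨a⟩` and generates a power of `a ^ N`. The only coset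
`b^f⟨a⟩` that an excursion can meet is the one of its first letter, and it does so exactly when
`f = e` and the exponent of `v` is divisible by `N`. -/
theorem bijOn_excursion (N : ℕ) (B : Set Bool) (e : Bool) :
    Set.BijOn (excursion e)
      ({v | v ∈ wordsC N B ∧ ¬ (e ∈ B ∧ (N : ℤ) ∣ (run N v).2)} ×ˢ
        {u | u ∈ wordsC N {!e} ∧ (N : ℤ) ∣ (run N u).2})
      {w | w ∈ wordsC N B ∧ w.getLast? = some (Gen.b, !e)} := by
  refine ⟨?_, ?_, ?_⟩
  · rintro ⟨v, u⟩ ⟨⟨⟨hv1, hv2⟩, hv3⟩, ⟨hu1, hu2⟩, hu3⟩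
    have hu := hu2 _ rfl
    dsimp only at *
    refine ⟨⟨?_, ?_⟩, by rw [excursion, List.getLast?_concat]⟩
    · rw [run_excursion hv1 hu hu1 hu3]
    · intro f hf
      rw [excursion, avoids_concat_iff]
      constructor
      · intro p hp
        rcases prefix_append_cons_iff.1 hp with h | ⟨q, hq, rfl⟩
        · exact hv2 f hf p h
        · rw [run_append_cons hv1 (hu.mono hq)]
          intro h
          rw [List.append_eq_singleton_iff] at h
          simp only [List.cons.injEq, Prod.mk.injEq, and_true, reduceCtorEq, and_false,
            or_false] at h
          obtain ⟨-, h2, rfl⟩ := h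
          exact hv3 ⟨hf, Int.dvd_of_emod_eq_zero h2⟩
      · have := run_excursion hv1 hu hu1 hu3
        rw [excursion] at this
        rw [this]
        simp
  · -- `v` is the longest proper prefix lying in `⟨a⟩`, hence determined by the word
    have key : ∀ v u v' u' : Word, (run N v).1 = [] → Avoids N (!e) u → (run N v').1 = [] →
        v ++ (Gen.b, e) :: u = v' ++ (Gen.b, e) :: u' → v' <+: v := by
      intro v u v' u' hv hu hv' h
      have hp : v' <+: v ++ (Gen.b, e) :: u := h ▸ List.prefix_append _ _
      rcases prefix_append_cons_iff.1 hp with h | ⟨q, hq, rfl⟩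
      · exact h
      · rw [run_append_cons hv (hu.mono hq)] at hv'
        simp at hv'
    rintro ⟨v, u⟩ ⟨⟨⟨hv, -⟩, -⟩, ⟨-, hu⟩, -⟩ ⟨v', u'⟩ ⟨⟨⟨hv', -⟩, -⟩, ⟨-, hu'⟩, -⟩ h
    have h1 := List.append_cancel_right h
    have h2 := (key _ _ _ _ hv (hu _ rfl) hv' h1)
    have h3 := (key _ _ _ _ hv' (hu' _ rfl) hv h1.symm)
    have h4 : v = v' := h3.eq_of_length_le h2.length_le
    subst h4
    simpa using h1
  · rintro w ⟨⟨hw1, hw2⟩, hw3⟩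
    obtain ⟨y, rfl⟩ := List.getLast?_eq_some_iff.1 hw3
    -- the longest prefix of `y` lying in `⟨a⟩`
    obtain ⟨v, ⟨hvy, hv⟩, hmax⟩ : ∃ v : Word, (v <+: y ∧ (run N v).1 = []) ∧
        ∀ v', v' <+: y → (run N v').1 = [] → v'.length ≤ v.length := by
      have hfin : {v : Word | v <+: y ∧ (run N v).1 = []}.Finite := by
        refine (List.finite_toSet y.inits).subset ?_
        intro v hv
        simpa using hv.1
      obtain ⟨v, hv, hmax⟩ := Set.exists_max_image _ List.length hfin ⟨[], List.nil_prefix, rfl⟩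
      exact ⟨v, hv, fun v' h1 h2 => hmax v' ⟨h1, h2⟩⟩
    obtain ⟨t, rfl⟩ := hvy
    rw [run_concat] at hw1
    rcases t with _ | ⟨⟨_ | _, f⟩, u⟩
    · rw [List.append_nil, ← Prod.mk.eta (p := run N v), hv] at hw1
      simp [act, stepB] at hw1
    · exfalso
      have h := hmax (v ++ [(Gen.a, f)])
        ((List.prefix_append_right_inj v).2 (List.cons_prefix_cons.2 ⟨rfl, List.nil_prefix⟩))
        (by rw [run_concat]; cases f <;> exact hv)
      simp at h
    · have hu : Avoids N (!f) u := by
        refine (avoids_of_foldl_act_ne_nil (d := (run N v).2 - (run N v).2 % N)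
          (i := (run N v).2 % N) Int.dvd_self_sub_emod fun p hp h0 => ?_).1
        have h := hmax (v ++ (Gen.b, f) :: p)
          ((List.prefix_append_right_inj v).2 (List.cons_prefix_cons.2 ⟨rfl, hp⟩)) (by
            rw [← h0, run, List.foldl_append, List.foldl_cons]
            congr 2
            change act N (run N v) _ = _
            rw [← Prod.mk.eta (p := run N v), hv]
            rfl)
        simp at h
      rw [run_append_cons hv hu] at hw1
      -- the last letter empties the stack, so it pops the entry pushed after `v`
      obtain ⟨hu1, hu2, rfl⟩ : (run N u).1 = [] ∧ (N : ℤ) ∣ (run N u).2 ∧ f = e := by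
        have hd : (N : ℤ) ∣ (run N v).2 - (run N v).2 % N := Int.dvd_self_sub_emod
        simp only [act, stepB_add _ _ _ hd] at hw1
        match h : (run N u).1 with
        | [] =>
          rw [h, List.nil_append, stepB] at hw1
          split_ifs at hw1 with hc
          exact ⟨rfl, Int.dvd_of_emod_eq_zero hc.1, by simpa using hc.2⟩
        | (j, g) :: τ =>
          rw [h, List.cons_append, stepB] at hw1
          split_ifs at hw1 with hc
          simp at hw1
      refine ⟨(v, u), ⟨⟨⟨hv, fun e he => (hw2 e he).mono ?_⟩, ?_⟩, ⟨hu1, ?_⟩, hu2⟩, rfl⟩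
      · rw [List.append_assoc]
        exact List.prefix_append _ _
      · rintro ⟨hB, hd⟩
        refine hw2 _ hB (v ++ [(Gen.b, f)]) ?_ ?_
        · rw [List.append_assoc]
          exact (List.prefix_append_right_inj v).2 (List.cons_prefix_cons.2 ⟨rfl, List.nil_prefix⟩)
        · rw [run_append_cons hv (by simp [Avoids, run]), Int.emod_eq_zero_of_dvd hd]
          rfl
      · rintro _ rfl
        exact hu

theorem bijOn_concat_a (N : ℕ) (B : Set Bool) (e : Bool) :
    Set.BijOn (fun v : Word => v ++ [(Gen.a, e)]) (wordsC N B)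
      {w | w ∈ wordsC N B ∧ w.getLast? = some (Gen.a, e)} := by
  have hrun (v : Word) : (run N (v ++ [(Gen.a, e)])).1 = (run N v).1 := by
    rw [run_concat]; cases e <;> rfl
  refine ⟨?_, fun _ _ _ _ h => List.append_cancel_right h, ?_⟩
  · rintro v ⟨h1, h2⟩
    refine ⟨⟨by rw [hrun, h1], fun f hf => ?_⟩, List.getLast?_concat⟩
    rw [avoids_concat_iff, hrun, h1]
    exact ⟨h2 f hf, by simp⟩
  · rintro w ⟨⟨h1, h2⟩, h3⟩
    obtain ⟨v, rfl⟩ := List.getLast?_eq_some_iff.1 h3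
    rw [hrun] at h1
    exact ⟨v, ⟨h1, fun f hf => (h2 f hf).mono (List.prefix_append _ _)⟩, rfl⟩

/-! ### The symmetry `b ↔ b⁻¹` -/

/-- Exchange of the letters `b` and `b⁻¹`. -/
def flipLetter : Gen × Bool → Gen × Bool
  | (Gen.a, e) => (Gen.a, e)
  | (Gen.b, e) => (Gen.b, !e)

theorem flipLetter_flipLetter (l : Gen × Bool) : flipLetter (flipLetter l) = l := by
  rcases l with ⟨_ | _, e⟩ <;> simp [flipLetter]

/-- Exchange of `b` and `b⁻¹` in a word. -/
def flipWord (w : Word) : Word := w.map flipLetter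

theorem flipWord_flipWord (w : Word) : flipWord (flipWord w) = w := by
  simp [flipWord, Function.comp_def, flipLetter_flipLetter]

theorem run_flipWord (N : ℕ) (w : Word) :
    run N (flipWord w) = ((run N w).1.map fun c => (c.1, !c.2), (run N w).2) := by
  induction w using List.reverseRecOn with
  | nil => rfl
  | append_singleton w l ih =>
    rw [flipWord, List.map_append] at *
    rw [List.map_singleton, run_concat, run_concat, ih]
    generalize run N w = s
    obtain ⟨σ, m⟩ := s
    rcases l with ⟨_ | _, e⟩
    · cases e <;> rfl
    · match σ with
      | [] => rfl
      | (j, g) :: τ =>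
        have : (!g) = e ↔ g = !e := by cases g <;> cases e <;> simp
        simp only [flipLetter, act, stepB, List.map_cons, Bool.not_not, this]
        split_ifs <;> simp

theorem Avoids.flipWord {N : ℕ} {e : Bool} {w : Word} (h : Avoids N e w) :
    Avoids N (!e) (flipWord w) := by
  rintro p hp h0
  have hp' : BaumslagSolitar.flipWord p <+: w := by
    have := hp.map flipLetter
    rwa [← BaumslagSolitar.flipWord, ← BaumslagSolitar.flipWord, flipWord_flipWord] at this
  refine h _ hp' ?_
  rw [run_flipWord, h0]
  simp

theorem bijOn_flipWord (N : ℕ) (e : Bool) :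
    Set.BijOn flipWord (wordsC N {e}) (wordsC N {!e}) := by
  have key (e : Bool) : Set.MapsTo flipWord (wordsC N {e}) (wordsC N {!e}) := by
    rintro w ⟨h1, h2⟩
    refine ⟨by rw [run_flipWord, h1]; rfl, ?_⟩
    rintro _ rfl
    exact (h2 e rfl).flipWord
  have h := key (!e)
  rw [Bool.not_not] at h
  exact Set.BijOn.mk (key e) (fun w _ w' _ h => by
    rw [← flipWord_flipWord w, h, flipWord_flipWord])
    fun w hw => ⟨flipWord w, h hw, flipWord_flipWord w⟩

/-! ### Generating functions -/

open scoped Classical in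
/-- The words of length `n` in `S`. -/
def wordsOfLength (S : Set Word) (n : ℕ) : Finset Word :=
  (List.finite_length_eq (Gen × Bool) n).toFinset.filter (· ∈ S)

theorem mem_wordsOfLength {S : Set Word} {n : ℕ} {w : Word} :
    w ∈ wordsOfLength S n ↔ w ∈ S ∧ w.length = n := by
  simp [wordsOfLength, and_comm]

/-- The sum of `z ^ |w| * q ^ k` over the words `w` in `S`, where `k` is the exponent of `a` in the
normal form of `w`. -/
def weightSum (N : ℕ) (S : Set Word) : Series ℤ :=
  PowerSeries.mk fun n => ∑ w ∈ wordsOfLength S n, LaurentPolynomial.T (run N w).2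

theorem coeff_sum_T {ι : Type*} (s : Finset ι) (f : ι → ℤ) (k : ℤ) :
    (∑ i ∈ s, LaurentPolynomial.T (f i) : LaurentPolynomial ℤ).coeff k =
      (s.filter fun i => f i = k).card := by
  rw [AddMonoidAlgebra.coeff_sum, Finsupp.finsetSum_apply]
  simp

/-- For words in `⟨a⟩` the generating function is a sum over words instead of over exponents. -/
theorem genFun_eq_weightSum {N : ℕ} (hN : 1 ≤ N) {S : Set Word} (hS : ∀ w ∈ S, (run N w).1 = []) :
    genFun N N S = weightSum N S := by
  ext n k
  rw [coeff_genFun hN hN, weightSum, PowerSeries.coeff_mk, coeff_sum_T, count,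
    ← Set.ncard_coe_finset]
  congr 2
  ext w
  simp only [Finset.coe_filter, mem_wordsOfLength, Set.mem_ofPred_eq, val_eq_zpow_iff hN, and_assoc]
  exact and_congr_right fun h => and_congr_right fun _ =>
    ⟨fun h => by rw [h], fun h' => Prod.ext (hS w h) h'⟩

theorem weightSum_congr {N : ℕ} {S S' : Set Word} (f : Word → Word) (hf : Set.BijOn f S S')
    (hlen : ∀ w ∈ S, (f w).length = w.length) (hk : ∀ w ∈ S, (run N (f w)).2 = (run N w).2) :
    weightSum N S = weightSum N S' := by
  ext1 n
  rw [weightSum, weightSum, PowerSeries.coeff_mk, PowerSeries.coeff_mk]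
  refine Finset.sum_nbij f ?_ ?_ ?_ ?_
  · intro w hw
    rw [mem_wordsOfLength] at *
    exact ⟨hf.mapsTo hw.1, by rw [hlen w hw.1, hw.2]⟩
  · exact hf.injOn.mono fun w hw => (mem_wordsOfLength.1 hw).1
  · intro w hw
    obtain ⟨h1, h2⟩ := mem_wordsOfLength.1 hw
    obtain ⟨v, hv, rfl⟩ := hf.surjOn h1
    exact ⟨v, mem_wordsOfLength.2 ⟨hv, by rw [← hlen v hv, h2]⟩, rfl⟩
  · intro w hw
    rw [hk w (mem_wordsOfLength.1 hw).1]

/-- Unambiguous concatenation, with `c` extra letters, multiplies generating functions. -/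
theorem weightSum_mul {N : ℕ} {A B S : Set Word} (f : Word × Word → Word) (c : ℕ)
    (hf : Set.BijOn f (A ×ˢ B) S)
    (hlen : ∀ p ∈ A ×ˢ B, (f p).length = p.1.length + p.2.length + c)
    (hk : ∀ p ∈ A ×ˢ B, (run N (f p)).2 = (run N p.1).2 + (run N p.2).2) :
    weightSum N S = zz ℤ ^ c * (weightSum N A * weightSum N B) := by
  ext1 n
  rw [zz, PowerSeries.coeff_X_pow_mul', weightSum, PowerSeries.coeff_mk]
  split_ifs with hn
  · rw [PowerSeries.coeff_mul]
    simp only [weightSum, PowerSeries.coeff_mk, Finset.sum_mul_sum, ← Finset.sum_product',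
      ← LaurentPolynomial.T_add]
    rw [Finset.sum_sigma']
    symm
    have hmem {x : (_ : ℕ × ℕ) × (Word × Word)} :
        x ∈ (Finset.HasAntidiagonal.antidiagonal (n - c)).sigma (fun y =>
          wordsOfLength A y.1 ×ˢ wordsOfLength B y.2) ↔
          x.2 ∈ A ×ˢ B ∧ x.1 = (x.2.1.length, x.2.2.length) ∧
            x.2.1.length + x.2.2.length + c = n := by
      obtain ⟨⟨i, j⟩, u, v⟩ := x
      simp only [Finset.mem_sigma, Finset.HasAntidiagonal.mem_antidiagonal,
        Finset.mem_product, mem_wordsOfLength, Set.mem_prod, Prod.mk.injEq]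
      constructor
      · rintro ⟨h, ⟨h1, rfl⟩, h2, rfl⟩
        exact ⟨⟨h1, h2⟩, ⟨rfl, rfl⟩, by omega⟩
      · rintro ⟨⟨h1, h2⟩, ⟨rfl, rfl⟩, h⟩
        exact ⟨by omega, ⟨h1, rfl⟩, h2, rfl⟩
    refine Finset.sum_nbij (fun x => f x.2) ?_ ?_ ?_ ?_
    · intro x hx
      rw [hmem] at hx
      exact mem_wordsOfLength.2 ⟨hf.mapsTo hx.1, by rw [hlen _ hx.1, hx.2.2]⟩
    · rintro ⟨x, p⟩ hx ⟨y, p'⟩ hy h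
      rw [Finset.mem_coe, hmem] at hx hy
      obtain rfl : p = p' := hf.injOn hx.1 hy.1 h
      rw [Sigma.mk.injEq]
      exact ⟨hx.2.1.trans hy.2.1.symm, HEq.rfl⟩
    · intro w hw
      obtain ⟨h1, h2⟩ := mem_wordsOfLength.1 hw
      obtain ⟨p, hp, rfl⟩ := hf.surjOn h1
      refine ⟨⟨(p.1.length, p.2.length), p⟩, hmem.2 ⟨hp, rfl, ?_⟩, rfl⟩
      rw [← hlen p hp, h2]
    · intro x hx
      rw [hk _ (hmem.1 hx).1]
  · refine Finset.sum_eq_zero fun w hw => ?_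
    obtain ⟨h1, h2⟩ := mem_wordsOfLength.1 hw
    obtain ⟨p, hp, rfl⟩ := hf.surjOn h1
    have := hlen p hp
    omega

theorem weightSum_concat_a {N : ℕ} {A S : Set Word} (e : Bool)
    (hf : Set.BijOn (fun v : Word => v ++ [(Gen.a, e)]) A S) :
    weightSum N S = zz ℤ * PowerSeries.C (LaurentPolynomial.T (sgn e)) * weightSum N A := by
  have hrun (v : Word) : (run N (v ++ [(Gen.a, e)])).2 = sgn e + (run N v).2 := by
    rw [run_concat]; cases e <;> simp [act, sgn] <;> ring
  ext1 n
  rw [mul_assoc, zz, ← pow_one PowerSeries.X, PowerSeries.coeff_X_pow_mul', weightSum,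
    PowerSeries.coeff_mk]
  split_ifs with hn
  · rw [PowerSeries.coeff_C_mul, weightSum, PowerSeries.coeff_mk, Finset.mul_sum]
    symm
    refine Finset.sum_nbij (fun v => v ++ [(Gen.a, e)]) ?_ ?_ ?_ ?_
    · intro v hv
      obtain ⟨h1, h2⟩ := mem_wordsOfLength.1 hv
      exact mem_wordsOfLength.2 ⟨hf.mapsTo h1, by simp [h2, hn]⟩
    · exact hf.injOn.mono fun w hw => (mem_wordsOfLength.1 hw).1
    · intro w hw
      obtain ⟨h1, h2⟩ := mem_wordsOfLength.1 hw
      obtain ⟨v, hv, rfl⟩ := hf.surjOn h1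
      exact ⟨v, mem_wordsOfLength.2 ⟨hv, by simp [← h2]⟩, rfl⟩
    · intro v _
      rw [hrun, LaurentPolynomial.T_add]
  · refine Finset.sum_eq_zero fun w hw => ?_
    obtain ⟨h1, h2⟩ := mem_wordsOfLength.1 hw
    obtain ⟨v, hv, rfl⟩ := hf.surjOn h1
    simp at h2
    omega

theorem weightSum_union {N : ℕ} {A B : Set Word} (h : Disjoint A B) :
    weightSum N (A ∪ B) = weightSum N A + weightSum N B := by
  ext1 n
  rw [map_add, weightSum, weightSum, weightSum, PowerSeries.coeff_mk, PowerSeries.coeff_mk,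
    PowerSeries.coeff_mk, ← Finset.sum_union]
  · congr 1
    ext w
    simp [mem_wordsOfLength, or_and_right]
  · rw [Finset.disjoint_left]
    intro w h1 h2
    exact h.le_bot ⟨(mem_wordsOfLength.1 h1).1, (mem_wordsOfLength.1 h2).1⟩

theorem weightSum_singleton_nil (N : ℕ) : weightSum N {[]} = 1 := by
  ext1 n
  rw [weightSum, PowerSeries.coeff_mk, PowerSeries.coeff_one]
  split_ifs with hn
  · have : wordsOfLength {[]} n = {[]} := by
      ext w
      rw [mem_wordsOfLength, hn]
      simp
    rw [this, Finset.sum_singleton]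
    exact LaurentPolynomial.T_zero
  · refine Finset.sum_eq_zero fun w hw => ?_
    obtain ⟨rfl, h⟩ := mem_wordsOfLength.1 hw
    exact absurd h.symm hn

/-- Splitting according to the last letter; the term `1` is the empty word. -/
theorem weightSum_eq_sum_getLast {N : ℕ} {S : Set Word} (h : [] ∈ S) :
    weightSum N S = 1 + ∑ l : Gen × Bool, weightSum N {w | w ∈ S ∧ w.getLast? = some l} := by
  have key : ∀ t : Finset (Gen × Bool),
      weightSum N {w | w ∈ S ∧ ∀ l, w.getLast? = some l → l ∈ t} =
        1 + ∑ l ∈ t, weightSum N {w | w ∈ S ∧ w.getLast? = some l} := by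
    intro t
    induction t using Finset.induction_on with
    | empty =>
      rw [Finset.sum_empty, add_zero, ← weightSum_singleton_nil N]
      congr 1
      ext w
      simp only [Finset.notMem_empty, Set.mem_ofPred_eq, Set.mem_singleton_iff]
      constructor
      · rintro ⟨-, h2⟩
        exact List.getLast?_eq_none_iff.1 (Option.eq_none_iff_forall_ne_some.2 h2)
      · rintro rfl
        simpa using h
    | insert l t hl ih =>
      rw [Finset.sum_insert hl, add_left_comm, ← ih, ← weightSum_union]
      · congr 1
        ext w
        simp only [Finset.mem_insert, Set.mem_ofPred_eq, Set.mem_union]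
        constructor
        · rintro ⟨h1, h2⟩
          by_cases h3 : w.getLast? = some l
          · exact Or.inl ⟨h1, h3⟩
          · exact Or.inr ⟨h1, fun l' hl' => (h2 l' hl').resolve_left (by rintro rfl; exact h3 hl')⟩
        · rintro (⟨h1, h2⟩ | ⟨h1, h2⟩)
          · exact ⟨h1, fun l' hl' => Or.inl (Option.some.inj (hl'.symm.trans h2))⟩
          · exact ⟨h1, fun l' hl' => Or.inr (h2 l' hl')⟩
      · rw [Set.disjoint_left]
        rintro w ⟨-, h1⟩ ⟨-, h2⟩
        exact hl (h2 l h1)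
  rw [← key]
  congr 1
  ext w
  simp

theorem coeff_Phi {N : ℕ} (f : Series ℤ) (n : ℕ) (k : ℤ) :
    (PowerSeries.coeff n (Phi N N f)).coeff k =
      if (N : ℤ) ∣ k then (PowerSeries.coeff n f).coeff k else 0 := by
  rw [Phi, PowerSeries.coeff_mk]
  generalize PowerSeries.coeff n f = p
  rw [Finsupp.sum, AddMonoidAlgebra.coeff_sum, Finsupp.finsetSum_apply,
    Finset.sum_eq_single k]
  · split_ifs with h
    · rw [Int.mul_ediv_cancel' h, AddMonoidAlgebra.coeff_single, Finsupp.single_eq_same]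
    · simp
  · intro j _ hj
    split_ifs with h
    · rw [Int.mul_ediv_cancel' h, AddMonoidAlgebra.coeff_single, Finsupp.single_eq_of_ne hj.symm]
    · simp
  · intro hk
    rw [Finsupp.notMem_support_iff.1 hk]
    simp

theorem Phi_weightSum (N : ℕ) (S : Set Word) :
    Phi N N (weightSum N S) = weightSum N {w | w ∈ S ∧ (N : ℤ) ∣ (run N w).2} := by
  ext n k
  rw [coeff_Phi, weightSum, weightSum, PowerSeries.coeff_mk, PowerSeries.coeff_mk, coeff_sum_T,
    coeff_sum_T]
  split_ifs with h
  · congr 2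
    ext w
    simp only [Finset.mem_filter, mem_wordsOfLength, Set.mem_ofPred_eq]
    constructor
    · rintro ⟨⟨h1, h2⟩, rfl⟩
      exact ⟨⟨⟨h1, h⟩, h2⟩, rfl⟩
    · rintro ⟨⟨⟨h1, h⟩, h2⟩, rfl⟩
      exact ⟨⟨h1, h2⟩, rfl⟩
  · symm
    rw [Nat.cast_eq_zero, Finset.card_eq_zero, Finset.filter_eq_empty_iff]
    rintro w hw rfl
    exact h (mem_wordsOfLength.1 hw).1.2

theorem QQ_one : QQ (1 : ℤˣ) =
    PowerSeries.C (LaurentPolynomial.T 1) + PowerSeries.C (LaurentPolynomial.T (-1)) := by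
  simp [QQ]

open scoped Classical in
/-- The last-letter decomposition: a nonempty word ends in `a`, in `a⁻¹`, or in an excursion. -/
theorem weightSum_wordsC (N : ℕ) (B : Set Bool) :
    weightSum N (wordsC N B) = 1 + zz ℤ * QQ 1 * weightSum N (wordsC N B) +
      ∑ e : Bool, zz ℤ ^ 2 * ((weightSum N (wordsC N B) -
        if e ∈ B then Phi N N (weightSum N (wordsC N B)) else 0) *
          Phi N N (weightSum N (wordsC N {!e}))) := by
  have ha (e : Bool) := weightSum_concat_a (N := N) e (bijOn_concat_a N B e)
  have hb (e : Bool) : weightSum N {w | w ∈ wordsC N B ∧ w.getLast? = some (Gen.b, !e)} =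
      zz ℤ ^ 2 * ((weightSum N (wordsC N B) -
        if e ∈ B then Phi N N (weightSum N (wordsC N B)) else 0) *
          Phi N N (weightSum N (wordsC N {!e}))) := by
    rw [weightSum_mul (excursion e) 2 (bijOn_excursion N B e), Phi_weightSum N (wordsC N {!e})]
    · congr 2
      rw [eq_sub_iff_add_eq]
      split_ifs with he
      · rw [Phi_weightSum, ← weightSum_union]
        · congr 1
          ext w
          simp only [he, true_and, Set.mem_union, Set.mem_ofPred_eq]
          tauto
        · rw [Set.disjoint_left]
          rintro w ⟨-, h1⟩ ⟨-, h2⟩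
          exact h1 ⟨he, h2⟩
      · rw [add_zero]
        congr 1
        ext w
        simp [he]
    · rintro ⟨v, u⟩ _
      simp [excursion]
      ring
    · rintro ⟨v, u⟩ ⟨⟨⟨hv, -⟩, -⟩, ⟨hu1, hu2⟩, hu3⟩
      rw [run_excursion hv (hu2 _ rfl) hu1 hu3]
  have hnil : [] ∈ wordsC N B := ⟨rfl, by simp [Avoids, run]⟩
  have hG (F : Gen → Series ℤ) : ∑ x : Gen, F x = F Gen.a + F Gen.b := by
    rw [show (Finset.univ : Finset Gen) = {Gen.a, Gen.b} from rfl]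
    simp
  have h0 := hb false
  have h1 := hb true
  rw [Bool.not_false] at h0
  rw [Bool.not_true] at h1
  conv_lhs => rw [weightSum_eq_sum_getLast hnil]
  rw [Fintype.sum_prod_type, hG, Fintype.sum_bool, Fintype.sum_bool, Fintype.sum_bool, ha, ha, h0,
    h1, QQ_one]
  simp only [sgn, if_true, Bool.false_eq_true, if_false, Bool.not_true, Bool.not_false]
  ring

theorem weightSum_wordsC_not (N : ℕ) (e : Bool) :
    weightSum N (wordsC N {!e}) = weightSum N (wordsC N {e}) :=
  (weightSum_congr flipWord (bijOn_flipWord N e) (fun w _ => by simp [flipWord])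
    fun w _ => by rw [run_flipWord]).symm

theorem serL_eq {N : ℕ} (hN : 1 ≤ N) : serL N N = weightSum N (wordsC N {false}) := by
  rw [serL, wordsL_eq hN, genFun_eq_weightSum hN fun w hw => hw.1]

theorem weightSum_wordsC_singleton {N : ℕ} (hN : 1 ≤ N) (e : Bool) :
    weightSum N (wordsC N {e}) = serL N N := by
  rw [serL_eq hN]
  cases e
  · rfl
  · rw [← weightSum_wordsC_not, Bool.not_true]

theorem serK_eq_serL {N : ℕ} (hN : 1 ≤ N) : serK N N = serL N N := by
  rw [serK, wordsK_eq hN, genFun_eq_weightSum hN fun w hw => hw.1, weightSum_wordsC_singleton hN]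

theorem serL_equation {N : ℕ} (hN : 1 ≤ N) :
    serL N N = 1 + zz ℤ * QQ 1 * serL N N + 2 * zz ℤ ^ 2 * serL N N * Phi N N (serL N N)
        - zz ℤ ^ 2 * Phi N N (serL N N) ^ 2 := by
  have h := weightSum_wordsC N {false}
  simp only [Fintype.sum_bool, Set.mem_singleton_iff, Bool.true_eq_false, if_true, if_false,
    weightSum_wordsC_singleton hN] at h
  linear_combination h

theorem serG_equation {N : ℕ} (hN : 1 ≤ N) :
    serG N N = 1 + zz ℤ * QQ 1 * serG N N + 2 * zz ℤ ^ 2 * serG N N * Phi N N (serL N N) := by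
  have h := weightSum_wordsC N ∅
  have hG : serG N N = weightSum N (wordsC N ∅) := by
    rw [serG, wordsH_eq hN, genFun_eq_weightSum hN fun w hw => hw.1]
  simp only [Fintype.sum_bool, Set.mem_empty_iff_false, if_false, sub_zero,
    weightSum_wordsC_singleton hN, ← hG] at h
  linear_combination h

/-! ### Components modulo `N` -/

/-- The part of a Laurent polynomial with exponents congruent to `r` modulo `N`. -/
def laurentPart (N : ℕ) (r : ZMod N) : LaurentPolynomial ℤ →+ LaurentPolynomial ℤ where
  toFun p := AddMonoidAlgebra.ofCoeff (p.coeff.filter fun k : ℤ => (k : ZMod N) = r)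
  map_zero' := by ext k; simp [Finsupp.filter_apply]
  map_add' p q := by ext k; simp only [AddMonoidAlgebra.coeff_add, Finsupp.filter_add]

theorem coeff_laurentPart (N : ℕ) (r : ZMod N) (p : LaurentPolynomial ℤ) (k : ℤ) :
    (laurentPart N r p).coeff k = if (k : ZMod N) = r then p.coeff k else 0 :=
  Finsupp.filter_apply _ _ _

theorem laurentPart_single {N : ℕ} (r : ZMod N) (d c : ℤ) :
    laurentPart N r (AddMonoidAlgebra.single d c) =
      if (d : ZMod N) = r then AddMonoidAlgebra.single d c else 0 := by
  ext k
  rw [coeff_laurentPart, AddMonoidAlgebra.coeff_single]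
  by_cases hk : d = k
  · subst hk
    split_ifs <;> rfl
  · have h0 : (Finsupp.single d c : ℤ →₀ ℤ) k = 0 := Finsupp.single_eq_of_ne (Ne.symm hk)
    rw [h0, ite_self]
    split_ifs
    · exact h0.symm
    · rfl

theorem laurentPart_single_mul {N : ℕ} (r : ZMod N) (d c : ℤ) (p : LaurentPolynomial ℤ) :
    laurentPart N r (AddMonoidAlgebra.single d c * p) =
      AddMonoidAlgebra.single d c * laurentPart N (r - d) p := by
  ext k
  rw [coeff_laurentPart, AddMonoidAlgebra.coeff_single_mul_apply,
    AddMonoidAlgebra.coeff_single_mul_apply, coeff_laurentPart]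
  have : ((-d + k : ℤ) : ZMod N) = r - d ↔ (k : ZMod N) = r := by
    push_cast
    rw [neg_add_eq_sub, sub_left_inj]
  rw [if_congr this rfl rfl]
  split_ifs <;> simp

theorem laurentPart_zero_mul {N : ℕ} (r : ZMod N) (p q : LaurentPolynomial ℤ) :
    laurentPart N r (laurentPart N 0 p * q) = laurentPart N 0 p * laurentPart N r q := by
  induction p using AddMonoidAlgebra.induction_linear with
  | zero => simp
  | add f g hf hg => rw [map_add, add_mul, map_add, hf, hg, add_mul]
  | single d c =>
    rw [laurentPart_single]
    split_ifs with hd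
    · rw [laurentPart_single_mul, hd, sub_zero]
    · simp

/-- The part of a series with exponents of `q` congruent to `r` modulo `N`. -/
def part (N : ℕ) (r : ZMod N) : Series ℤ →+ Series ℤ where
  toFun f := PowerSeries.mk fun n => laurentPart N r (PowerSeries.coeff n f)
  map_zero' := by ext1 n; simp
  map_add' f g := by ext1 n; simp

theorem coeff_part (N : ℕ) (r : ZMod N) (f : Series ℤ) (n : ℕ) :
    PowerSeries.coeff n (part N r f) = laurentPart N r (PowerSeries.coeff n f) := by
  exact PowerSeries.coeff_mk n fun n => laurentPart N r (PowerSeries.coeff n f)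

theorem part_zero_eq_Phi (N : ℕ) (f : Series ℤ) : part N 0 f = Phi N N f := by
  ext n k
  rw [coeff_part, coeff_laurentPart, coeff_Phi]
  exact if_congr (ZMod.intCast_zmod_eq_zero_iff_dvd k N) rfl rfl

theorem part_Phi_mul {N : ℕ} (r : ZMod N) (f g : Series ℤ) :
    part N r (Phi N N f * g) = Phi N N f * part N r g := by
  ext1 n
  rw [← part_zero_eq_Phi, coeff_part, PowerSeries.coeff_mul, PowerSeries.coeff_mul, map_sum]
  simp only [coeff_part, laurentPart_zero_mul]

theorem part_zz_mul {N : ℕ} (r : ZMod N) (f : Series ℤ) :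
    part N r (zz ℤ * f) = zz ℤ * part N r f := by
  ext1 n
  rw [coeff_part, zz, ← pow_one PowerSeries.X, PowerSeries.coeff_X_pow_mul',
    PowerSeries.coeff_X_pow_mul']
  split_ifs
  · rw [coeff_part]
  · simp

theorem part_T_mul {N : ℕ} (r : ZMod N) (d : ℤ) (f : Series ℤ) :
    part N r (PowerSeries.C (LaurentPolynomial.T d) * f) =
      PowerSeries.C (LaurentPolynomial.T d) * part N (r - d) f := by
  ext1 n
  rw [coeff_part, PowerSeries.coeff_C_mul, PowerSeries.coeff_C_mul, coeff_part,
    LaurentPolynomial.T, laurentPart_single_mul]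

theorem part_one {N : ℕ} (r : ZMod N) : part N r 1 = if r = 0 then 1 else 0 := by
  ext1 n
  have h : laurentPart N r 1 = if r = 0 then 1 else 0 := by
    have := laurentPart_single r 0 1
    rw [Int.cast_zero] at this
    exact this.trans (if_congr eq_comm rfl rfl)
  rw [coeff_part, PowerSeries.coeff_one, apply_ite (laurentPart N r), h, map_zero,
    apply_ite (PowerSeries.coeff n), PowerSeries.coeff_one, map_zero]
  split_ifs <;> rfl

/-- The components of the equation for `L`. The series `L₀` only involves exponents divisible by
`N`, so it acts as a scalar, while multiplication by `q` and `q⁻¹` shifts the component. -/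
theorem part_serL_equation {N : ℕ} (hN : 1 ≤ N) (r : ZMod N) :
    (1 - 2 * zz ℤ ^ 2 * serL0 N) * part N r (serL N N) =
      (if r = 0 then 1 - zz ℤ ^ 2 * serL0 N ^ 2 else 0) +
        zz ℤ * PowerSeries.C (LaurentPolynomial.T 1) * part N (r - 1) (serL N N) +
        zz ℤ * PowerSeries.C (LaurentPolynomial.T (-1)) * part N (r + 1) (serL N N) := by
  have h := serL_equation hN
  rw [QQ_one] at h
  have h2 : serL N N = 1 + zz ℤ * (PowerSeries.C (LaurentPolynomial.T 1) * serL N N) +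
      zz ℤ * (PowerSeries.C (LaurentPolynomial.T (-1)) * serL N N) +
      (zz ℤ * (zz ℤ * (Phi N N (serL N N) * serL N N)) +
        zz ℤ * (zz ℤ * (Phi N N (serL N N) * serL N N))) -
      zz ℤ * (zz ℤ * (Phi N N (serL N N) * (Phi N N (serL N N) * 1))) := by
    linear_combination h
  have h3 := congrArg (part N r) h2
  simp only [map_add, map_sub, part_zz_mul, part_T_mul, part_Phi_mul, part_one] at h3
  push_cast at h3
  rw [sub_neg_eq_add, ← serL0] at h3
  split_ifs at h3 ⊢ <;> linear_combination h3

theorem part_zero_serL (N : ℕ) : part N 0 (serL N N) = serL0 N := part_zero_eq_Phi _ _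

/-! ### The cubic equation -/

/-- For `N = 2` the components of `L` satisfy two linear equations, from which the odd one is
eliminated; then `L₀` is expressed by `G`. -/
theorem cubic_two : 1 + 3 * zz ℤ * QQ 1 * serG 2 2
      - (1 - 4 * zz ℤ ^ 2 - zz ℤ ^ 2 * QQ 1 ^ 2) * serG 2 2 ^ 2
      - zz ℤ * QQ 1 * (1 - zz ℤ * QQ 1 - 2 * zz ℤ) * (1 - zz ℤ * QQ 1 + 2 * zz ℤ) *
          serG 2 2 ^ 3 = 0 := by
  have h0 := part_serL_equation (le_of_lt one_lt_two) (0 : ZMod 2)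
  have h1 := part_serL_equation (le_of_lt one_lt_two) (1 : ZMod 2)
  have hG := serG_equation (le_of_lt one_lt_two)
  rw [← serL0] at hG
  have e1 : (0 - 1 : ZMod 2) = 1 := by decide
  have e2 : (1 + 1 : ZMod 2) = 0 := by decide
  rw [if_pos rfl, e1, zero_add, part_zero_serL] at h0
  rw [if_neg one_ne_zero, sub_self, e2, part_zero_serL] at h1
  rw [QQ_one] at *
  generalize (PowerSeries.C (LaurentPolynomial.T 1) : Series ℤ) = q at *
  generalize (PowerSeries.C (LaurentPolynomial.T (-1)) : Series ℤ) = q' at *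
  generalize zz ℤ = z at *
  generalize serL0 2 = x at *
  generalize part 2 1 (serL 2 2) = l at *
  generalize serG 2 2 = g at *
  -- `x` is `L₀`, `l` the odd part of `L`, and `g` is `G`
  have hx : x * ((1 - 2 * z ^ 2 * x) ^ 2 - (z * (q + q')) ^ 2) =
      (1 - z ^ 2 * x ^ 2) * (1 - 2 * z ^ 2 * x) := by
    linear_combination (1 - 2 * z ^ 2 * x) * h0 + z * (q + q') * h1
  have hg : 2 * z ^ 2 * x * g = (1 - z * (q + q')) * g - 1 := by linear_combination -hG
  generalize q + q' = Q at *
  have hgx : (2 * z ^ 2 * x * g) * (((1 - 2 * z ^ 2 * x) * g) ^ 2 - (z * Q * g) ^ 2) * 2  =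
      (4 * z ^ 2 * g ^ 2 - (2 * z ^ 2 * x * g) ^ 2) * ((1 - 2 * z ^ 2 * x) * g) := by
    linear_combination 4 * z ^ 2 * g ^ 3 * hx
  have ht : (1 - 2 * z ^ 2 * x) * g = z * Q * g + 1 := by linear_combination -hg
  rw [ht, hg] at hgx
  linear_combination -hgx

/-! ### The roots of unity filter -/

theorem substQ_zz (c : ℂˣ) : substQ c (zz ℤ) = zz ℂ := PowerSeries.map_X _

theorem substQ_QQ_one (c : ℂˣ) : substQ c (QQ 1) = QQ c := by
  rw [QQ_one, map_add, substQ, PowerSeries.map_C, PowerSeries.map_C, LaurentPolynomial.eval₂_T,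
    LaurentPolynomial.eval₂_T, zpow_one, zpow_neg, zpow_one, ← map_add]
  rfl

theorem scaledQ_zpow (c : ℂˣ) (d : ℤ) :
    ((scaledQ c ^ d : (LaurentPolynomial ℂ)ˣ) : LaurentPolynomial ℂ) =
      LaurentPolynomial.C ((c ^ d : ℂˣ) : ℂ) * ((scaledQ 1 ^ d : (LaurentPolynomial ℂ)ˣ) :
        LaurentPolynomial ℂ) := by
  have h : scaledQ c = Units.map (LaurentPolynomial.C : ℂ →+* LaurentPolynomial ℂ) c *
      scaledQ 1 := by
    ext1
    simp [scaledQ]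
  rw [h, mul_zpow, Units.val_mul, ← map_zpow]
  rfl

/-- The substitution `q ↦ c * q` on coefficients. -/
def laurentSubst (c : ℂˣ) : LaurentPolynomial ℤ →+* LaurentPolynomial ℂ :=
  LaurentPolynomial.eval₂ (LaurentPolynomial.C.comp (Int.castRingHom ℂ)) (scaledQ c)

theorem coeff_substQ (c : ℂˣ) (f : Series ℤ) (n : ℕ) :
    PowerSeries.coeff n (substQ c f) = laurentSubst c (PowerSeries.coeff n f) :=
  PowerSeries.coeff_map _ _ _

theorem laurentSubst_single (c : ℂˣ) (d a : ℤ) :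
    laurentSubst c (AddMonoidAlgebra.single d a) = LaurentPolynomial.C ((c ^ d : ℂˣ) : ℂ) *
      laurentSubst 1 (AddMonoidAlgebra.single d a) := by
  rw [laurentSubst, laurentSubst, LaurentPolynomial.single_eq_C_mul_T,
    LaurentPolynomial.eval₂_C_mul_T, LaurentPolynomial.eval₂_C_mul_T, scaledQ_zpow c]
  ring

theorem omega_isPrimitiveRoot {N : ℕ} (hN : 1 ≤ N) : IsPrimitiveRoot (omega N) N := by
  rw [← IsPrimitiveRoot.coe_units_iff]
  exact Complex.isPrimitiveRoot_exp N (by omega)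

theorem sum_omega_zpow {N : ℕ} (hN : 1 ≤ N) (d : ℤ) :
    ∑ j ∈ Finset.range N, (((omega N ^ j) ^ d : ℂˣ) : ℂ) =
      if (d : ZMod N) = 0 then (N : ℂ) else 0 := by
  have hcomm (j : ℕ) : (((omega N ^ j) ^ d : ℂˣ) : ℂ) = ((omega N ^ d : ℂˣ) : ℂ) ^ j := by
    rw [← Units.val_pow_eq_pow_val, ← zpow_natCast, ← zpow_natCast, zpow_comm]
  simp only [hcomm]
  split_ifs with hd
  · rw [ZMod.intCast_zmod_eq_zero_iff_dvd, ← (omega_isPrimitiveRoot hN).zpow_eq_one_iff_dvd] at hd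
    simp [hd]
  · rw [ZMod.intCast_zmod_eq_zero_iff_dvd, ← (omega_isPrimitiveRoot hN).zpow_eq_one_iff_dvd] at hd
    have h1 : ((omega N ^ d : ℂˣ) : ℂ) - 1 ≠ 0 := by
      rw [sub_ne_zero]
      exact fun h => hd (Units.ext h)
    refine (mul_eq_zero.1 ?_).resolve_right h1
    rw [geom_sum_mul, ← Units.val_pow_eq_pow_val, ← zpow_natCast, zpow_comm, zpow_natCast,
      (omega_isPrimitiveRoot hN).pow_eq_one]
    simp

theorem natCast_mul_laurentSubst_laurentPart {N : ℕ} (hN : 1 ≤ N) (p : LaurentPolynomial ℤ) :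
    (N : LaurentPolynomial ℂ) * laurentSubst 1 (laurentPart N 0 p) =
      ∑ j ∈ Finset.range N, laurentSubst (omega N ^ j) p := by
  induction p using AddMonoidAlgebra.induction_linear with
  | zero => simp
  | add f g hf hg => simp only [map_add, mul_add, hf, hg, Finset.sum_add_distrib]
  | single d a =>
    simp only [laurentSubst_single (omega N ^ _), ← Finset.sum_mul, ← map_sum,
      sum_omega_zpow hN, laurentPart_single]
    split_ifs
    · rw [map_natCast]
    · simp

/-- Averaging over the substitutions `q ↦ ω ^ j * q` extracts the exponents divisible by `N`. -/
theorem natCast_mul_substQ_Phi {N : ℕ} (hN : 1 ≤ N) (f : Series ℤ) :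
    (N : Series ℂ) * substQ 1 (Phi N N f) = ∑ j ∈ Finset.range N, substQ (omega N ^ j) f := by
  ext1 n
  rw [← map_natCast (PowerSeries.C (R := LaurentPolynomial ℂ)) N, PowerSeries.coeff_C_mul,
    coeff_substQ, ← part_zero_eq_Phi, coeff_part, natCast_mul_laurentSubst_laurentPart hN, map_sum]
  simp only [coeff_substQ]

/-- The substitution `q ↦ c * q` with `c ^ N = 1` fixes the series in `q ^ N`. -/
theorem substQ_Phi {N : ℕ} {c : ℂˣ} (hc : c ^ N = 1) (f : Series ℤ) :
    substQ c (Phi N N f) = substQ 1 (Phi N N f) := by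
  ext1 n
  rw [coeff_substQ, coeff_substQ, ← part_zero_eq_Phi, coeff_part]
  induction PowerSeries.coeff n f using AddMonoidAlgebra.induction_linear with
  | zero => simp
  | add f g hf hg => simp only [map_add, hf, hg]
  | single d a =>
    rw [laurentPart_single]
    split_ifs with hd
    · rw [ZMod.intCast_zmod_eq_zero_iff_dvd] at hd
      obtain ⟨k, rfl⟩ := hd
      rw [laurentSubst_single c, zpow_mul, zpow_natCast, hc, one_zpow]
      simp
    · simp

theorem substQ_serL0 {N : ℕ} {c : ℂˣ} (hc : c ^ N = 1) :
    substQ c (serL0 N) = substQ 1 (serL0 N) := substQ_Phi hc _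

theorem omega_pow_pow {N : ℕ} (hN : 1 ≤ N) (j : ℕ) : (omega N ^ j) ^ N = 1 := by
  rw [pow_right_comm, (omega_isPrimitiveRoot hN).pow_eq_one, one_pow]

theorem isUnit_of_constantCoeff_eq_one {R : Type*} [CommRing R] {f : Series R}
    (h : PowerSeries.constantCoeff f = 1) : IsUnit f :=
  PowerSeries.isUnit_iff_constantCoeff.2 (by rw [h]; exact isUnit_one)

theorem isUnit_denominator (c : ℂˣ) (f : Series ℂ) :
    IsUnit (1 - zz ℂ * QQ c - 2 * zz ℂ ^ 2 * f) :=
  isUnit_of_constantCoeff_eq_one (by simp [zz])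

theorem substQ_serL {N : ℕ} (hN : 1 ≤ N) {c : ℂˣ} (hc : c ^ N = 1) :
    substQ c (serL N N) = (1 - zz ℂ ^ 2 * substQ 1 (serL0 N) ^ 2) *
      Ring.inverse (1 - zz ℂ * QQ c - 2 * zz ℂ ^ 2 * substQ 1 (serL0 N)) := by
  rw [Ring.eq_mul_inverse_iff_mul_eq _ _ _ (isUnit_denominator _ _)]
  have h := congrArg (substQ c) (serL_equation hN)
  rw [← serL0] at h
  simp only [map_add, map_sub, map_mul, map_pow, map_one, map_ofNat, substQ_zz, substQ_QQ_one,
    substQ_serL0 hc] at h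
  linear_combination h

/-! ### Algebraicity -/

open Polynomial in
/-- The matrix of the linear system satisfied by the components of `L`, with `L₀` replaced by an
indeterminate. -/
def systemMatrix {A : Type*} [CommRing A] (N : ℕ) (t t' : A) :
    Matrix (ZMod N) (ZMod N) A[X][X] :=
  fun r s => (if s = r then 1 - 2 * C X ^ 2 * X else 0) -
    (if s = r - 1 then C (X * C t) else 0) - (if s = r + 1 then C (X * C t') else 0)

open Polynomial in
/-- Cramer's rule expresses `det M * v 0` by the adjugate of the system matrix `M`, which is an
algebraic relation for `v 0`, the only unknown occurring in `M`. -/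
theorem isAlgebraic_of_cyclic_system {A : Type*} [CommRing A] [Nontrivial A] {N : ℕ} [NeZero N]
    (t t' : A) (v : ZMod N → PowerSeries A)
    (hv : ∀ r, (1 - 2 * PowerSeries.X ^ 2 * v 0) * v r =
      (if r = 0 then 1 - PowerSeries.X ^ 2 * v 0 ^ 2 else 0) +
        PowerSeries.X * PowerSeries.C t * v (r - 1) +
        PowerSeries.X * PowerSeries.C t' * v (r + 1)) :
    IsAlgebraic A[X] (v 0) := by
  refine ⟨(systemMatrix N t t').det * X -
    (1 - C X ^ 2 * X ^ 2) * (systemMatrix N t t').adjugate 0 0, ?_, ?_⟩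
  · -- at `z = 0` the matrix is the identity and the polynomial is `X - 1`
    intro h0
    let ψ : A[X][X] →+* A[X] := mapRingHom (evalRingHom 0)
    have hM : ψ.mapMatrix (systemMatrix N t t') = 1 := by
      ext1 r s
      rw [RingHom.mapMatrix_apply, Matrix.map_apply, systemMatrix, Matrix.one_apply]
      simp only [map_sub, apply_ite ψ, map_zero]
      simp [ψ, eq_comm]
    have h1 := congrArg ψ h0
    have h2 := congrFun (congrFun (ψ.map_adjugate (systemMatrix N t t')) 0) 0
    rw [RingHom.mapMatrix_apply, Matrix.map_apply] at h2
    rw [map_sub, map_mul, map_mul, RingHom.map_det, h2, hM, Matrix.det_one, Matrix.adjugate_one,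
      Matrix.one_apply_eq] at h1
    simp only [ψ, map_sub, map_mul, map_pow, map_one, map_zero, coe_mapRingHom, map_X, map_C,
      coe_evalRingHom, eval_X] at h1
    refine X_sub_C_ne_zero (1 : A) ?_
    rw [C_1]
    linear_combination h1
  · let φ : A[X][X] →+* PowerSeries A := (aeval (v 0)).toRingHom
    change φ _ = 0
    have hX : φ X = v 0 := aeval_X _
    have hC (p : A[X]) : φ (C p) = (p : PowerSeries A) := by
      simp [φ, aeval_C, PowerSeries.algebraMap_apply']
    let M := φ.mapMatrix (systemMatrix N t t')
    have hMv : M.mulVec v = Pi.single 0 (1 - PowerSeries.X ^ 2 * v 0 ^ 2) := by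
      ext1 r
      have h := hv r
      have hM (s : ZMod N) : M r s = (if s = r then 1 - 2 * PowerSeries.X ^ 2 * v 0 else 0) -
          (if s = r - 1 then PowerSeries.X * PowerSeries.C t else 0) -
          (if s = r + 1 then PowerSeries.X * PowerSeries.C t' else 0) := by
        simp only [M, RingHom.mapMatrix_apply, Matrix.map_apply, systemMatrix, map_sub,
          apply_ite φ, map_zero, hC]
        simp [hX, hC, show φ 2 = 2 from map_ofNat φ 2, ← PowerSeries.X_mul]
      simp only [Matrix.mulVec, dotProduct, hM, sub_mul, ite_mul, zero_mul,
        Finset.sum_sub_distrib, Finset.sum_ite_eq', Finset.mem_univ, if_true, Pi.single_apply]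
      linear_combination h
    have h := congrFun (congrArg (M.adjugate.mulVec ·) hMv) 0
    simp only [Matrix.mulVec_mulVec, Matrix.adjugate_mul, Matrix.smul_mulVec, Matrix.one_mulVec,
      Pi.smul_apply, Matrix.mulVec_single, smul_eq_mul, Matrix.col_apply,
      MulOpposite.smul_eq_mul_unop, MulOpposite.unop_op] at h
    have h2 := congrFun (congrFun (φ.map_adjugate (systemMatrix N t t')) 0) 0
    rw [RingHom.mapMatrix_apply, Matrix.map_apply] at h2
    rw [map_sub, map_mul, map_mul, RingHom.map_det, h2]
    simp only [map_sub, map_mul, map_pow, map_one, hX, hC, coe_X]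
    linear_combination h

theorem isAlg_serL0 {N : ℕ} (hN : 1 ≤ N) : IsAlg (serL0 N) := by
  have : NeZero N := ⟨by omega⟩
  have h := isAlgebraic_of_cyclic_system (LaurentPolynomial.T 1) (LaurentPolynomial.T (-1))
    (fun r : ZMod N => part N r (serL N N)) fun r => by
      simp only [part_zero_serL]
      exact part_serL_equation hN r
  rwa [part_zero_serL] at h

theorem isAlg_of_polynomial (p : Polynomial (LaurentPolynomial ℤ)) : IsAlg (p : Series ℤ) := by
  have := isAlgebraic_algebraMap (R := Polynomial (LaurentPolynomial ℤ)) (A := Series ℤ) p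
  rwa [PowerSeries.algebraMap_apply', Algebra.algebraMap_self, PowerSeries.map_id] at this

theorem isAlg_zz : IsAlg (zz ℤ) := by
  rw [zz, ← Polynomial.coe_X]
  exact isAlg_of_polynomial _

theorem isAlg_QQ : IsAlg (QQ (1 : ℤˣ)) := by
  rw [QQ, ← Polynomial.coe_C]
  exact isAlg_of_polynomial _

theorem isAlg_one : IsAlg 1 := isAlgebraic_one

theorem isAlg_of_mul_denominator {N : ℕ} (hN : 1 ≤ N) {f : Series ℤ}
    (h : IsAlg (f * (1 - zz ℤ * QQ 1 - 2 * zz ℤ ^ 2 * serL0 N))) : IsAlg f := by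
  have hL := isAlg_serL0 hN
  have h2 : IsAlg (2 : Series ℤ) := isAlgebraic_natCast 2
  have hd : IsAlg (1 - zz ℤ * QQ 1 - 2 * zz ℤ ^ 2 * serL0 N) :=
    (isAlg_one.sub (isAlg_zz.mul isAlg_QQ)).sub ((h2.mul (isAlg_zz.pow 2)).mul hL)
  refine IsAlgebraic.of_mul (IsUnit.mem_nonZeroDivisors ?_) hd ?_
  · exact isUnit_of_constantCoeff_eq_one (by simp [zz])
  · rwa [mul_comm]

theorem isAlg_serL {N : ℕ} (hN : 1 ≤ N) : IsAlg (serL N N) := by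
  refine isAlg_of_mul_denominator hN ?_
  have h := serL_equation hN
  rw [← serL0] at h
  have h' : serL N N * (1 - zz ℤ * QQ 1 - 2 * zz ℤ ^ 2 * serL0 N) =
      1 - zz ℤ ^ 2 * serL0 N ^ 2 := by linear_combination h
  rw [h']
  exact isAlg_one.sub ((isAlg_zz.pow 2).mul ((isAlg_serL0 hN).pow 2))

theorem isAlg_serG {N : ℕ} (hN : 1 ≤ N) : IsAlg (serG N N) := by
  refine isAlg_of_mul_denominator hN ?_
  have h := serG_equation hN
  rw [← serL0] at h
  have h' : serG N N * (1 - zz ℤ * QQ 1 - 2 * zz ℤ ^ 2 * serL0 N) = 1 := by linear_combination h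
  rw [h']
  exact isAlg_one

end BaumslagSolitar

end

open BaumslagSolitar
theorem mainTheorem3 :
    (∀ N : ℕ, 1 ≤ N →
      -- `K = L`
      serK N N = serL N N ∧
      -- the equation for `L`
      serL N N = 1 + zz ℤ * QQ 1 * serL N N + 2 * zz ℤ ^ 2 * serL N N * Phi N N (serL N N)
        - zz ℤ ^ 2 * Phi N N (serL N N) ^ 2 ∧
      -- the equation for `G`
      serG N N = 1 + zz ℤ * QQ 1 * serG N N + 2 * zz ℤ ^ 2 * serG N N * Phi N N (serL N N) ∧
      -- the roots of unity filter
      (N : Series ℂ) * substQ 1 (serL0 N) =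
        ∑ j ∈ Finset.range N, substQ (omega N ^ j) (serL N N) ∧
      -- the denominators of the next equation are invertible
      (∀ j ∈ Finset.range N, IsUnit
        (1 - zz ℂ * QQ (omega N ^ j) - 2 * zz ℂ ^ 2 * substQ 1 (serL0 N))) ∧
      -- the algebraic equation for `L₀`
      (N : Series ℂ) * substQ 1 (serL0 N) =
        ∑ j ∈ Finset.range N, (1 - zz ℂ ^ 2 * substQ 1 (serL0 N) ^ 2) *
          Ring.inverse (1 - zz ℂ * QQ (omega N ^ j) - 2 * zz ℂ ^ 2 * substQ 1 (serL0 N)) ∧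
      -- algebraicity
      IsAlg (serL0 N) ∧ IsAlg (serL N N) ∧ IsAlg (serG N N)) ∧
    -- the cubic equation for `N = 2`
    1 + 3 * zz ℤ * QQ 1 * serG 2 2
      - (1 - 4 * zz ℤ ^ 2 - zz ℤ ^ 2 * QQ 1 ^ 2) * serG 2 2 ^ 2
      - zz ℤ * QQ 1 * (1 - zz ℤ * QQ 1 - 2 * zz ℤ) * (1 - zz ℤ * QQ 1 + 2 * zz ℤ) *
          serG 2 2 ^ 3 = 0 := by
  refine ⟨fun N hN => ⟨serK_eq_serL hN, serL_equation hN, serG_equation hN,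
    natCast_mul_substQ_Phi hN _, fun j _ => isUnit_denominator _ _, ?_, isAlg_serL0 hN,
    isAlg_serL hN, isAlg_serG hN⟩, cubic_two⟩
  rw [serL0, natCast_mul_substQ_Phi hN]
  exact Finset.sum_congr rfl fun j _ => substQ_serL hN (omega_pow_pow hN j)
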